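/- Let $n\ge 1$, let $\mathbb B^n=\{z\in\mathbb C^n:\|z\|<1\}$ be the Euclidean unit ball, and write $dg_z$ for the complex differential of $g$ at $z$. A normalized Loewner chain on $\mathbb B^n$ is a family $(f_t)_{t\ge 0}$ of injective holomorphic maps $f_t:\mathbb B^n\to\mathbb C^n$ with $f_t(0)=0$ and $d(f_t)_0=e^t\,\mathrm{id}$ for all $t\ge0$, such that for all $0\le s\le t$ there is a holomorphic $\varphi_{s,t}:\mathbb B^n\to\mathbb B^n$ with $\varphi_{s,t}(0)=0$ and $f_s=f_t\circ\varphi_{s,t}$. It is a normal Loewner chain if, moreover, $\{e^{-t}f_t\}_{t\ge 0}$ is a normal family on $\mathbb B^n$, i.e. every sequence in it has a subsequence that converges uniformly on compact subsets of $\mathbb B^n$. For $T>0$, a normalized Loewner chain $(f_t)_{t\ge0}$ is called geräumig in $[0,T)$ if there are $a,b>0$ and $c\in(0,1]$ such that 1. $\min_{\|v\|=1}\|d(f_t)_z(v)\|\ge a$ for all $t\in[0,T)$ and all $z\in\mathbb B^n$; 2. $\left\|\frac{\partial f_t}{\partial t}(z)\right\|\le b$ for a.e. $t\in[0,T)$ and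 all $z\in\mathbb B^n$; 3. $\operatorname{Re}\left\langle [d(f_t)_z]^{-1}\frac{\partial f_t}{\partial t}(z),\frac{z}{\|z\|^2}\right\rangle\ge c$ for a.e. $t\in[0,T)$ and all $z\in\mathbb B^n\setminus\{0\}$. **Theorem.** Let $0<T<\infty$ and let $(f_t)_{t\ge0}$ be a normalized (respectively, normal) Loewner chain on $\mathbb B^n$ that is geräumig in $[0,T)$. Then there exists $\epsilon_0>0$ such that for every $\epsilon\in(0,\epsilon_0]$, setting $\alpha(t)=\epsilon\left(1-\frac tT\right)$ for $t\in[0,T)$ and $\alpha(t)=0$ for $t\ge T$, the family $(f_t+\alpha(t)h)_{t\ge0}$ is a normalized (respectively, normal) Loewner chain on $\mathbb B^n$ for every holomorphic $h:\mathbb B^n\to\mathbb C^n$ with $h(0)=0$, $dh_0=0$, $\sup_{z\in\mathbb B^n}\|h(z)\|\le1$ and $\sup_{z\in\mathbb B^n}\|dh_z\|\le1$ (operator norm). -/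

import Mathlib

open MeasureTheory Filter Topology

noncomputable section

namespace Loewner

/-- The space `ℂⁿ` with its Euclidean norm and Hermitian inner product. -/
abbrev Cn (n : ℕ) : Type := EuclideanSpace ℂ (Fin n)

/-- The open Euclidean unit ball of `ℂⁿ`. -/
abbrev unitBall (n : ℕ) : Set (Cn n) := Metric.ball 0 1

/-- A normalized subordination chain `(f_t)_{t ≥ 0}` on the unit ball. Only the values `f t z` with
`0 ≤ t` and `z` in the unit ball are relevant. -/
structure IsNormalizedSubordinationChain {n : ℕ} (f : ℝ → Cn n → Cn n) : Prop where
  holomorphic : ∀ t, 0 ≤ t → DifferentiableOn ℂ (f t) (unitBall n)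
  map_zero : ∀ t, 0 ≤ t → f t 0 = 0
  fderiv_zero : ∀ t, 0 ≤ t →
    fderiv ℂ (f t) 0 = ((Real.exp t : ℝ) : ℂ) • ContinuousLinearMap.id ℂ (Cn n)
  subordinate : ∀ s t, 0 ≤ s → s ≤ t → ∃ φ : Cn n → Cn n,
    DifferentiableOn ℂ φ (unitBall n) ∧ Set.MapsTo φ (unitBall n) (unitBall n) ∧
      φ 0 = 0 ∧ ∀ z ∈ unitBall n, f s z = f t (φ z)

/-- A normalized Loewner chain: a normalized subordination chain all of whose elements are
univalent (holomorphic and injective) on the unit ball. -/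
structure IsNormalizedLoewnerChain {n : ℕ} (f : ℝ → Cn n → Cn n) : Prop
    extends IsNormalizedSubordinationChain f where
  univalent : ∀ t, 0 ≤ t → Set.InjOn (f t) (unitBall n)

/-- A family of maps is normal on `U` if every sequence in it has a subsequence converging uniformly
on compact subsets of `U` (for holomorphic maps the limit is then holomorphic on `U`).
Compactly divergent subsequences need not be allowed here: the definition is only used for families
of maps that all vanish at the origin. -/
def IsNormalFamily {n : ℕ} (F : Set (Cn n → Cn n)) (U : Set (Cn n)) : Prop :=
  ∀ u : ℕ → Cn n → Cn n, (∀ k, u k ∈ F) →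
    ∃ (σ : ℕ → ℕ) (g : Cn n → Cn n), StrictMono σ ∧
      ∀ K ⊆ U, IsCompact K → TendstoUniformlyOn (fun k => u (σ k)) g atTop K

/-- A normal Loewner chain: a normalized Loewner chain for which `{e^{-t} f_t}_{t ≥ 0}` is a normal
family on the unit ball. -/
structure IsNormalLoewnerChain {n : ℕ} (f : ℝ → Cn n → Cn n) : Prop
    extends IsNormalizedLoewnerChain f where
  normal : IsNormalFamily
    {g | ∃ t : ℝ, 0 ≤ t ∧ g = fun z => ((Real.exp (-t) : ℝ) : ℂ) • f t z} (unitBall n)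

/-- `μ(A) = min_{‖v‖ = 1} ‖A v‖`. -/
def minStretch {n : ℕ} (A : Cn n →L[ℂ] Cn n) : ℝ :=
  ⨅ v : Metric.sphere (0 : Cn n) 1, ‖A v‖

/-- `(f_t)` is exponentially squeezing on the time interval `I` with squeezing ratio `a`:
`Re ⟨[d(f_t)_z]⁻¹ (∂f_t/∂t)(z), z / ‖z‖²⟩ ≥ a` for a.e. `t ∈ I` and all `z ≠ 0` in the unit ball.
Since `a > 0`, the inequality fails whenever the inverse or the time derivative takes its default
value `0`; so it forces `d(f_t)_z` to be invertible and the time derivative to exist. -/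
def IsExpSqueezingWith {n : ℕ} (f : ℝ → Cn n → Cn n) (I : Set ℝ) (a : ℝ) : Prop :=
  0 < a ∧ a ≤ 1 ∧ ∀ᵐ t : ℝ, t ∈ I → ∀ z ∈ unitBall n, z ≠ 0 →
    a ≤ (inner ℂ ((fderiv ℂ (f t) z).inverse (deriv (fun s => f s z) t))
      (((‖z‖ ^ 2)⁻¹ : ℝ) • z)).re

/-- `(f_t)` is geräumig (spacious) on the time interval `I`. -/
def IsGeraumigOn {n : ℕ} (f : ℝ → Cn n → Cn n) (I : Set ℝ) : Prop :=
  ∃ a b : ℝ, 0 < a ∧ 0 < b ∧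
    (∀ t ∈ I, ∀ z ∈ unitBall n, a ≤ minStretch (fderiv ℂ (f t) z)) ∧
    (∀ᵐ t : ℝ, t ∈ I → ∀ z ∈ unitBall n, ‖deriv (fun s => f s z) t‖ ≤ b) ∧
    ∃ c : ℝ, IsExpSqueezingWith f I c

/-- The function `α` equal to `ε (1 - t / T)` for `t < T` and to `0` for `t ≥ T`. -/
def variationWeight (ε T t : ℝ) : ℝ := if t < T then ε * (1 - t / T) else 0

/-- The varied family `f_t + α(t) h`. -/
def variation {n : ℕ} (f : ℝ → Cn n → Cn n) (ε T : ℝ) (h : Cn n → Cn n) : ℝ → Cn n → Cn n :=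
  fun t z => f t z + ((variationWeight ε T t : ℝ) : ℂ) • h z

end Loewner

end

/-!
Write `g_t = f_t + α(t) h`. Since `g_t = f_t` for `t ≥ T`, everything happens on `[0, T]`, and the
point is to produce holomorphic self-maps `ψ` of the ball with `g_s = g_t ∘ ψ` and to carry the
univalence of `g_T = f_T` back to earlier times. Formally `ψ` is the flow of the Loewner–Kufarev
field `v = -(dg_t)⁻¹ ∂_t g_t`, which depends only measurably on `t`. No such differential equation
is solved here. Instead, the constant path at a value `p = g_s(z)` is lifted through the family:
the differentials `dg_t` are uniformly bounded below, hence for a time step that depends only on a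
radius `r < 1`, the equation `g_t(w(t)) = p` has a unique solution near any starting point of norm
at most `r`, and `w` is Lipschitz. At almost every time `w' = v(w)`, and `v` points inwards, so `‖w‖`
is nonincreasing; therefore the lift never leaves the ball of radius `r` and the steps can be
iterated up to time `T` (`IsInwardFamily.exists_step`, `IsInwardFamily.exists_lift`). Lifting two
points with the same image shows that univalence propagates backwards (`IsInwardFamily.injOn`), and
then `ψ = g_t⁻¹ ∘ g_s` is holomorphic (`IsInwardFamily.exists_transition`).

That `v` points inwards is the pointwise estimate `re_inner_nonpos_of_perturbation`. For the
unperturbed chain, `-⟪v, z⟫` has real part at least `c ‖z‖ ^ 2`. Adding `α h` changes `v` by a vector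
of norm `O(ε ‖z‖)`: by the Schwarz lemma both `h(z)` and `∂_t f_t(z)` are `O(‖z‖)`, and `(df_t)⁻¹` is
bounded.

A bound on `∂_t f_t` at almost every `t` yields a Lipschitz bound only once `t ↦ f_t(z)` is known to
be absolutely continuous. This holds for every normalized subordination chain
(`IsNormalizedSubordinationChain.exists_norm_sub_le`), because a holomorphic self-map `φ` of the ball
with `φ(0) = 0` and `dφ_0 = l • id` satisfies `‖z - φ(z)‖ = O(1 - l)` locally uniformly
(`norm_sub_apply_le_of_fderiv_eq_smul`).
-/

/-! ### Cauchy estimates on balls of a normed space -/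

section CauchyEstimates

variable {E F : Type*} [NormedAddCommGroup E] [NormedSpace ℂ E] [NormedAddCommGroup F]
  [NormedSpace ℂ F]

theorem norm_fderiv_le_of_norm_le_on_ball {f : E → F} {c : E} {R M : ℝ} (hR : 0 < R)
    (hd : DifferentiableOn ℂ f (Metric.ball c R)) (hM : ∀ z ∈ Metric.ball c R, ‖f z‖ ≤ M) :
    ‖fderiv ℂ f c‖ ≤ 2 * M / R := by
  refine Complex.norm_fderiv_le_div_of_mapsTo_ball hd (fun z hz => ?_) hR
  rw [Metric.mem_closedBall, dist_eq_norm]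
  calc ‖f z - f c‖ ≤ ‖f z‖ + ‖f c‖ := norm_sub_le _ _
    _ ≤ 2 * M := by linarith [hM z hz, hM c (Metric.mem_ball_self hR)]

theorem norm_sub_le_of_norm_le_on_ball {f : E → F} {r η M : ℝ} (hη : 0 < η)
    (hd : DifferentiableOn ℂ f (Metric.ball 0 (r + η)))
    (hM : ∀ z ∈ Metric.ball (0 : E) (r + η), ‖f z‖ ≤ M) {x y : E} (hx : ‖x‖ ≤ r) (hy : ‖y‖ ≤ r) :
    ‖f x - f y‖ ≤ 2 * M / η * ‖x - y‖ := by
  have hsub : ∀ z ∈ Metric.closedBall (0 : E) r, Metric.ball z η ⊆ Metric.ball 0 (r + η) := by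
    intro z hz
    refine Metric.ball_subset_ball' ?_
    linarith [Metric.mem_closedBall.1 hz]
  refine (convex_closedBall (0 : E) r).norm_image_sub_le_of_norm_fderiv_le (𝕜 := ℂ)
    (fun z hz => ?_) (fun z hz => ?_) (by simpa using hy) (by simpa using hx)
  · exact hd.differentiableAt (Metric.isOpen_ball.mem_nhds (hsub z hz (Metric.mem_ball_self hη)))
  · exact norm_fderiv_le_of_norm_le_on_ball hη (hd.mono (hsub z hz))
      fun w hw => hM w (hsub z hz hw)

/-- The derivative of a bounded holomorphic map is Lipschitz on a smaller ball. The Cauchy estimate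
is applied to the difference of two translates of the map, so that no second derivative is used. -/
theorem norm_fderiv_sub_le_of_norm_le_on_ball {f : E → F} {r η M : ℝ} (hη : 0 < η)
    (hd : DifferentiableOn ℂ f (Metric.ball 0 (r + η + η)))
    (hM : ∀ z ∈ Metric.ball (0 : E) (r + η + η), ‖f z‖ ≤ M) {x y : E} (hx : ‖x‖ ≤ r)
    (hy : ‖y‖ ≤ r) :
    ‖fderiv ℂ f x - fderiv ℂ f y‖ ≤ 4 * M / η ^ 2 * ‖x - y‖ := by
  have hd' : ∀ z : E, ‖z‖ < r + η + η → DifferentiableAt ℂ f z := fun z hz =>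
    hd.differentiableAt (Metric.isOpen_ball.mem_nhds (by simpa using hz))
  have hsh : ∀ w ∈ Metric.ball y η, ‖w‖ ≤ r + η ∧ ‖w + (x - y)‖ ≤ r + η := by
    intro w hw
    rw [Metric.mem_ball, dist_eq_norm] at hw
    constructor
    · calc ‖w‖ = ‖y + (w - y)‖ := by congr 1; abel
        _ ≤ ‖y‖ + ‖w - y‖ := norm_add_le _ _
        _ ≤ r + η := by linarith
    · calc ‖w + (x - y)‖ = ‖x + (w - y)‖ := by congr 1; abel
        _ ≤ ‖x‖ + ‖w - y‖ := norm_add_le _ _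
        _ ≤ r + η := by linarith
  have hcomp : ∀ w ∈ Metric.ball y η, HasFDerivAt (fun w => f (w + (x - y)) - f w)
      (fderiv ℂ f (w + (x - y)) - fderiv ℂ f w) w := by
    intro w hw
    obtain ⟨h1, h2⟩ := hsh w hw
    have ha : HasFDerivAt f (fderiv ℂ f (w + (x - y))) (w + (x - y)) :=
      (hd' _ (by linarith)).hasFDerivAt
    exact ((hasFDerivAt_comp_add_right (x - y)).2 ha).sub (hd' w (by linarith)).hasFDerivAt
  have hy' := hcomp y (Metric.mem_ball_self hη)
  have hk := norm_fderiv_le_of_norm_le_on_ball (M := 2 * M / η * ‖x - y‖) hη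
    (fun w hw => (hcomp w hw).differentiableAt.differentiableWithinAt) (fun w hw => by
      have := norm_sub_le_of_norm_le_on_ball hη hd hM (hsh w hw).2 (hsh w hw).1
      simpa using this)
  rw [hy'.fderiv, add_sub_cancel] at hk
  refine hk.trans (le_of_eq ?_)
  field_simp
  ring

theorem approximatesLinearOn_of_norm_le_on_ball {f : E → F} {r η M ρ : ℝ} {c : NNReal} (hη : 0 < η)
    (hd : DifferentiableOn ℂ f (Metric.ball 0 (r + η + η + η)))
    (hM : ∀ z ∈ Metric.ball (0 : E) (r + η + η + η), ‖f z‖ ≤ M) (hM0 : 0 ≤ M) (hρη : ρ ≤ η)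
    (hc : 4 * M / η ^ 2 * ρ ≤ c) {z : E} (hz : ‖z‖ ≤ r) :
    ApproximatesLinearOn f (fderiv ℂ f z) (Metric.closedBall z ρ) c := by
  intro x hx y hy
  have hsub : ∀ w ∈ Metric.closedBall z ρ, ‖w‖ ≤ r + η := by
    intro w hw
    rw [Metric.mem_closedBall, dist_eq_norm] at hw
    calc ‖w‖ = ‖z + (w - z)‖ := by congr 1; abel
      _ ≤ ‖z‖ + ‖w - z‖ := norm_add_le _ _
      _ ≤ r + η := by linarith
  refine (convex_closedBall z ρ).norm_image_sub_le_of_norm_fderiv_le' (𝕜 := ℂ)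
    (fun w hw => ?_) (fun w hw => ?_) hy hx
  · exact hd.differentiableAt (Metric.isOpen_ball.mem_nhds (by
      have := hsub w hw
      rw [mem_ball_zero_iff]; linarith))
  · refine le_trans (norm_fderiv_sub_le_of_norm_le_on_ball hη hd hM (hsub w hw) (by linarith)) ?_
    refine le_trans ?_ hc
    gcongr
    simpa [dist_eq_norm] using hw

end CauchyEstimates

/-! ### Self-maps of the ball whose derivative at the origin is nearly the identity -/

section Caratheodory

variable {E : Type*} [NormedAddCommGroup E] [InnerProductSpace ℂ E]

/-- On complex lines through the origin, `1 - ⟪u, φ (ζ u)⟫ / ζ` has nonnegative real part and the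
value `1 - l` at `ζ = 0`, so the Borel–Carathéodory inequality controls it by `1 - l`. -/
theorem norm_inner_self_sub_le {φ : E → E} {l : ℝ}
    (hd : DifferentiableOn ℂ φ (Metric.ball 0 1))
    (hmaps : Set.MapsTo φ (Metric.ball 0 1) (Metric.ball 0 1)) (h0 : φ 0 = 0)
    (hl : fderiv ℂ φ 0 = (l : ℂ) • ContinuousLinearMap.id ℂ E) (hl1 : l < 1) {z : E}
    (hz : ‖z‖ < 1) :
    ‖inner ℂ z (z - φ z)‖ ≤ 2 * (1 - l) / (1 - ‖z‖) := by
  rcases eq_or_ne z 0 with rfl | hz0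
  · simp; linarith
  have hzp : 0 < ‖z‖ := norm_pos_iff.2 hz0
  set u : E := ((‖z‖ : ℂ)⁻¹) • z with hu
  have hun : ‖u‖ = 1 := by
    rw [hu, norm_smul]; simp [hzp.ne']
  have hzu : z = (‖z‖ : ℂ) • u := by
    rw [hu, smul_smul, mul_inv_cancel₀ (by exact_mod_cast hzp.ne'), one_smul]
  have hmem : ∀ ζ ∈ Metric.ball (0 : ℂ) 1, ζ • u ∈ Metric.ball (0 : E) 1 := by
    intro ζ hζ
    rw [mem_ball_zero_iff] at hζ ⊢
    rw [norm_smul, hun, mul_one]; exact hζ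
  set k : ℂ → ℂ := fun ζ => inner ℂ u (φ (ζ • u)) with hk
  have hkd : DifferentiableOn ℂ k (Metric.ball 0 1) := by
    refine (innerSL ℂ u).differentiable.comp_differentiableOn (hd.comp ?_ hmem)
    fun_prop
  have hk0 : k 0 = 0 := by simp [hk, h0]
  have hkm : Set.MapsTo k (Metric.ball 0 1) (Metric.closedBall (k 0) 1) := by
    intro ζ hζ
    rw [hk0, mem_closedBall_zero_iff]
    have := hmaps (hmem ζ hζ)
    rw [mem_ball_zero_iff] at this
    calc ‖k ζ‖ ≤ ‖u‖ * ‖φ (ζ • u)‖ := norm_inner_le_norm _ _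
      _ ≤ 1 := by rw [hun, one_mul]; exact this.le
  have hk' : deriv k 0 = l := by
    have h1 : HasFDerivAt φ (fderiv ℂ φ 0) ((0 : ℂ) • u) := by
      rw [zero_smul]
      exact (hd.differentiableAt (Metric.ball_mem_nhds _ one_pos)).hasFDerivAt
    have h2 : HasDerivAt (fun ζ : ℂ => ζ • u) u 0 := by
      simpa using (hasDerivAt_id (0 : ℂ)).smul_const u
    have h3 := (innerSL ℂ u).hasFDerivAt.comp_hasDerivAt (0 : ℂ) (h1.comp_hasDerivAt (0 : ℂ) h2)
    have h4 : deriv k 0 = _ := h3.deriv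
    rw [h4, hl]
    simp [hun]
  set q : ℂ → ℂ := fun ζ => dslope k 0 ζ - l with hq
  have hqd : DifferentiableOn ℂ q (Metric.ball 0 1) :=
    ((Complex.differentiableOn_dslope (Metric.ball_mem_nhds _ one_pos)).2 hkd).sub_const _
  have hqre : Set.MapsTo q (Metric.ball 0 1) {w | w.re ≤ 1 - l} := by
    intro ζ hζ
    have := Complex.norm_dslope_le_div_of_mapsTo_ball hkd hkm hζ
    have h2 := Complex.re_le_norm (dslope k 0 ζ)
    simp only [Set.mem_ofPred_eq, hq, Complex.sub_re, Complex.ofReal_re]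
    linarith
  have hzb : (‖z‖ : ℂ) ∈ Metric.ball (0 : ℂ) 1 := by simpa using hz
  have hbc := Complex.borelCaratheodory_zero (by linarith : 0 < 1 - l) hqd hqre one_pos hzb
    (by simp [hq, hk'])
  have hzc : (‖z‖ : ℂ) ≠ 0 := by exact_mod_cast hzp.ne'
  have hkey : inner ℂ z (z - φ z) = (‖z‖ : ℂ) ^ 2 * (1 - l - q ‖z‖) := by
    have h1 : dslope k 0 (‖z‖ : ℂ) = (‖z‖ : ℂ)⁻¹ * k ‖z‖ := by
      rw [dslope_of_ne _ hzc, slope_def_field, hk0]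
      field_simp
      ring
    have h2 : inner ℂ z (φ z) = (‖z‖ : ℂ) * k ‖z‖ := by
      have : k (‖z‖ : ℂ) = inner ℂ u (φ z) := by simp only [hk]; rw [← hzu]
      rw [this]
      nth_rewrite 1 [hzu]
      rw [inner_smul_left]; simp
    rw [inner_sub_right, h2, inner_self_eq_norm_sq_to_K]
    simp only [hq, h1]
    field_simp
    simp only [Complex.coe_algebraMap]
    ring
  rw [hkey, norm_mul, norm_pow, Complex.norm_real, norm_norm]
  rw [Complex.norm_real, norm_norm] at hbc
  have h1l : ‖(1 - l : ℂ)‖ = 1 - l := by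
    rw [← Complex.ofReal_one, ← Complex.ofReal_sub, Complex.norm_real, Real.norm_of_nonneg]
    linarith
  have h1z : 0 < 1 - ‖z‖ := by linarith
  calc ‖z‖ ^ 2 * ‖(1 - l - q ‖z‖ : ℂ)‖ ≤ 1 * ‖(1 - l - q ‖z‖ : ℂ)‖ := by
        gcongr; exact pow_le_one₀ (norm_nonneg _) hz.le
    _ ≤ (1 - l) + 2 * (1 - l) * ‖z‖ / (1 - ‖z‖) := by
        rw [one_mul]
        exact (norm_sub_le _ _).trans (by rw [h1l]; gcongr)
    _ = (1 - l) * (1 + ‖z‖) / (1 - ‖z‖) := by field_simp; ring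
    _ ≤ 2 * (1 - l) / (1 - ‖z‖) := by
        gcongr ?_ / _
        nlinarith

/-- A vector field on a ball is controlled by its numerical range: for `‖v‖ = ρ` the function
`H ζ = ζ ⟪u, ψ (u + ζ v)⟫ + ⟪v, ψ (u + ζ v)⟫` is holomorphic, equals `⟪v, ψ u⟫` at `0`, and agrees
with `ζ ⟪u + ζ v, ψ (u + ζ v)⟫` on the unit circle, so the maximum principle applies. -/
theorem mul_norm_le_of_norm_inner_self_le {ψ : E → E} {r ρ C : ℝ} (hρ : 0 < ρ)
    (hd : DifferentiableOn ℂ ψ (Metric.ball 0 1)) (hr : r + ρ < 1)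
    (hC : ∀ z : E, ‖z‖ ≤ r + ρ → ‖inner ℂ z (ψ z)‖ ≤ C) {u : E} (hu : ‖u‖ ≤ r) :
    ρ * ‖ψ u‖ ≤ C := by
  rcases eq_or_ne (ψ u) 0 with h0 | h0
  · rw [h0, norm_zero, mul_zero]
    exact (norm_nonneg _).trans (hC u (by linarith))
  have hp : 0 < ‖ψ u‖ := norm_pos_iff.2 h0
  set v : E := ((ρ / ‖ψ u‖ : ℝ) : ℂ) • ψ u with hv
  have hvn : ‖v‖ = ρ := by
    rw [hv, norm_smul, Complex.norm_real, Real.norm_of_nonneg (by positivity)]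
    field_simp
  have hle : ∀ ζ : ℂ, ‖ζ‖ ≤ 1 → ‖u + ζ • v‖ ≤ r + ρ := by
    intro ζ hζ
    calc ‖u + ζ • v‖ ≤ ‖u‖ + ‖ζ • v‖ := norm_add_le _ _
      _ = ‖u‖ + ‖ζ‖ * ρ := by rw [norm_smul, hvn]
      _ ≤ r + 1 * ρ := by gcongr
      _ = r + ρ := by ring
  have hmem : Set.MapsTo (fun ζ : ℂ => u + ζ • v) (Metric.closedBall 0 1) (Metric.ball 0 1) := by
    intro ζ hζ
    rw [mem_closedBall_zero_iff] at hζ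
    rw [mem_ball_zero_iff]
    exact (hle ζ hζ).trans_lt hr
  set H : ℂ → ℂ := fun ζ => ζ * inner ℂ u (ψ (u + ζ • v)) + inner ℂ v (ψ (u + ζ • v)) with hH
  have hψ : DifferentiableOn ℂ (fun ζ : ℂ => ψ (u + ζ • v)) (Metric.closedBall 0 1) :=
    hd.comp (by fun_prop) hmem
  have hHd : DifferentiableOn ℂ H (Metric.closedBall 0 1) :=
    (differentiableOn_id.mul ((innerSL ℂ u).differentiable.comp_differentiableOn hψ)).add
      ((innerSL ℂ v).differentiable.comp_differentiableOn hψ)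
  have hcl : closure (Metric.ball (0 : ℂ) 1) = Metric.closedBall 0 1 := closure_ball _ one_ne_zero
  have hmax : ‖H 0‖ ≤ C := by
    refine Complex.norm_le_of_forall_mem_frontier_norm_le (U := Metric.ball (0 : ℂ) 1)
      Metric.isBounded_ball ?_ ?_ (subset_closure (Metric.mem_ball_self one_pos))
    · exact DifferentiableOn.diffContOnCl (by rwa [hcl])
    · intro ζ hζ
      rw [frontier_ball _ one_ne_zero, mem_sphere_zero_iff_norm] at hζ
      have hconj : ζ * (starRingEnd ℂ) ζ = 1 := by
        rw [Complex.mul_conj, Complex.normSq_eq_norm_sq, hζ]; simp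
      have : H ζ = ζ * inner ℂ (u + ζ • v) (ψ (u + ζ • v)) := by
        rw [inner_add_left, inner_smul_left, mul_add, ← mul_assoc, hconj, one_mul]
      rw [this, norm_mul, hζ, one_mul]
      exact hC _ (hle ζ hζ.le)
  have : H 0 = ((ρ * ‖ψ u‖ : ℝ) : ℂ) := by
    have hpc : (‖ψ u‖ : ℂ) ≠ 0 := by exact_mod_cast hp.ne'
    simp only [hH, zero_mul, zero_add, zero_smul, add_zero, hv, inner_smul_left,
      inner_self_eq_norm_sq_to_K]
    simp
    field_simp
  rw [this, Complex.norm_real, Real.norm_of_nonneg (by positivity)] at hmax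
  exact hmax

/-- A holomorphic self-map of the ball with derivative `l • id` at its fixed point `0` differs from
the identity by `O(1 - l)`, locally uniformly. The estimate is linear in `1 - l`, which a
Schwarz–Pick estimate on complex lines would not give in the directions orthogonal to the line. -/
theorem norm_sub_apply_le_of_fderiv_eq_smul {φ : E → E} {l r : ℝ}
    (hd : DifferentiableOn ℂ φ (Metric.ball 0 1))
    (hmaps : Set.MapsTo φ (Metric.ball 0 1) (Metric.ball 0 1)) (h0 : φ 0 = 0)
    (hl : fderiv ℂ φ 0 = (l : ℂ) • ContinuousLinearMap.id ℂ E) (hl1 : l < 1) (hr : r < 1) {z : E}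
    (hz : ‖z‖ ≤ r) :
    ‖z - φ z‖ ≤ 8 / (1 - r) ^ 2 * (1 - l) := by
  have h1r : 0 < 1 - r := by linarith
  have := mul_norm_le_of_norm_inner_self_le (ψ := fun z => z - φ z) (r := r) (ρ := (1 - r) / 2)
    (C := 4 * (1 - l) / (1 - r)) (by linarith) (differentiableOn_id.sub hd) (by linarith)
    (fun w hw => by
      refine (norm_inner_self_sub_le hd hmaps h0 hl hl1 (by linarith)).trans ?_
      rw [div_le_div_iff₀ (by linarith) h1r]
      nlinarith) hz
  calc ‖z - φ z‖ = ((1 - r) / 2 * ‖z - φ z‖) * (2 / (1 - r)) := by field_simp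
    _ ≤ (4 * (1 - l) / (1 - r)) * (2 / (1 - r)) := by gcongr
    _ = 8 / (1 - r) ^ 2 * (1 - l) := by field_simp; ring

end Caratheodory

/-! ### Lipschitz functions of a real variable and their almost everywhere derivative -/

theorem sub_le_mul_sub_of_ae_deriv_le {u : ℝ → ℝ} {s t C : ℝ} {K : NNReal} (hst : s ≤ t)
    (hu : LipschitzOnWith K u (Set.Icc s t))
    (hC : ∀ᵐ x : ℝ, x ∈ Set.Ioo s t → DifferentiableAt ℝ u x → deriv u x ≤ C) :
    u t - u s ≤ C * (t - s) := by
  have hac : AbsolutelyContinuousOnInterval u s t :=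
    LipschitzOnWith.absolutelyContinuousOnInterval (K := K) (by rwa [Set.uIcc_of_le hst])
  rw [← hac.integral_deriv_eq_sub]
  have h1 : ∀ᵐ x : ℝ, x ≠ s := by simp [ae_iff, measure_singleton]
  have h2 : ∀ᵐ x : ℝ, x ≠ t := by simp [ae_iff, measure_singleton]
  have h := intervalIntegral.integral_mono_ae_restrict (μ := volume) (g := fun _ => C) hst
    hac.intervalIntegrable_deriv intervalIntegrable_const (by
      rw [EventuallyLE, ae_restrict_iff' measurableSet_Icc]
      filter_upwards [hac.ae_differentiableAt, hC, h1, h2] with x hx1 hx2 hx3 hx4 hx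
      exact hx2 ⟨lt_of_le_of_ne hx.1 hx3.symm, lt_of_le_of_ne hx.2 hx4⟩
        (hx1 (by rwa [Set.uIcc_of_le hst])))
  refine h.trans (le_of_eq ?_)
  simp [mul_comm]

theorem norm_sub_le_mul_sub_of_ae_norm_deriv_le {E : Type*} [NormedAddCommGroup E]
    [InnerProductSpace ℂ E] [FiniteDimensional ℂ E] {w : ℝ → E} {s t C : ℝ} {K : NNReal}
    (hst : s ≤ t) (hC0 : 0 ≤ C) (hw : LipschitzOnWith K w (Set.Icc s t))
    (hC : ∀ᵐ x : ℝ, x ∈ Set.Ioo s t → ‖deriv w x‖ ≤ C) :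
    ‖w t - w s‖ ≤ C * (t - s) := by
  rcases eq_or_ne (w t - w s) 0 with h0 | h0
  · rw [h0, norm_zero]
    exact mul_nonneg hC0 (by linarith)
  set v := w t - w s with hv
  have hp : 0 < ‖v‖ := norm_pos_iff.2 h0
  let ℓ : E →L[ℝ] ℝ := Complex.reCLM.comp ((innerSL ℂ v).restrictScalars ℝ)
  have hℓ : ∀ x, ℓ x = (inner ℂ v x).re := fun x => rfl
  have h := sub_le_mul_sub_of_ae_deriv_le (C := ‖v‖ * C) hst (ℓ.lipschitz.comp_lipschitzOnWith hw)
    (by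
      filter_upwards [hw.ae_differentiableWithinAt_of_mem_real, hC] with x hx1 hx2 hx _
      have hwd : HasDerivAt w (deriv w x) x :=
        ((hx1 (Set.Ioo_subset_Icc_self hx)).differentiableAt
          (Icc_mem_nhds hx.1 hx.2)).hasDerivAt
      have : HasDerivAt (ℓ ∘ w) (ℓ (deriv w x)) x := ℓ.hasFDerivAt.comp_hasDerivAt x hwd
      rw [this.deriv, hℓ]
      calc (inner ℂ v (deriv w x)).re ≤ ‖inner ℂ v (deriv w x)‖ := Complex.re_le_norm _
        _ ≤ ‖v‖ * ‖deriv w x‖ := norm_inner_le_norm _ _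
        _ ≤ ‖v‖ * C := by gcongr; exact hx2 hx)
  have h2 : ℓ (w t) - ℓ (w s) = ‖v‖ * ‖v‖ := by
    rw [← map_sub, ← hv, hℓ]
    exact inner_self_eq_norm_mul_norm (𝕜 := ℂ) v
  simp only [Function.comp_apply] at h
  rw [h2, mul_assoc] at h
  exact le_of_mul_le_mul_left h hp

section Linearization

variable {E : Type*} [NormedAddCommGroup E] [NormedSpace ℂ E] {f : E → E} {A : E →L[ℂ] E}
  {s : Set E} {m ρ : ℝ} {z : E}

theorem exists_continuousLinearEquiv_of_bounded_below [FiniteDimensional ℂ E] (hm : 0 < m)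
    (hA : ∀ v, m * ‖v‖ ≤ ‖A v‖) : ∃ e : E ≃L[ℂ] E, (e : E →L[ℂ] E) = A := by
  have hinj : Function.Injective (A : E →ₗ[ℂ] E) := by
    refine (injective_iff_map_eq_zero _).2 fun v hv => ?_
    have := hA v
    have h0 : A v = 0 := hv
    rw [h0, norm_zero] at this
    exact norm_le_zero_iff.1 (nonpos_of_mul_nonpos_right this hm)
  refine ⟨(LinearEquiv.ofInjectiveEndo (A : E →ₗ[ℂ] E) hinj).toContinuousLinearEquiv, ?_⟩
  ext v
  simp

theorem ApproximatesLinearOn.mul_norm_sub_le_of_bounded_below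
    (hA : ∀ v, m * ‖v‖ ≤ ‖A v‖) (hf : ApproximatesLinearOn f A s (m / 2).toNNReal) (hm : 0 < m)
    {x y : E} (hx : x ∈ s) (hy : y ∈ s) : m / 2 * ‖x - y‖ ≤ ‖f x - f y‖ := by
  have h1 := hf x hx y hy
  rw [Real.coe_toNNReal _ (by positivity)] at h1
  have h2 := norm_sub_norm_le (A (x - y)) (A (x - y) - (f x - f y))
  rw [sub_sub_cancel, norm_sub_rev (A (x - y))] at h2
  linarith [hA (x - y)]

theorem ApproximatesLinearOn.exists_eq_of_bounded_below [FiniteDimensional ℂ E] (hm : 0 < m)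
    (hA : ∀ v, m * ‖v‖ ≤ ‖A v‖)
    (hf : ApproximatesLinearOn f A (Metric.closedBall z ρ) (m / 2).toNNReal) (hρ : 0 ≤ ρ) {p : E}
    (hp : ‖p - f z‖ ≤ m / 2 * ρ) : ∃ x, ‖x - z‖ ≤ ρ ∧ f x = p := by
  have : CompleteSpace E := FiniteDimensional.complete ℂ E
  obtain ⟨e, rfl⟩ := exists_continuousLinearEquiv_of_bounded_below hm hA
  let e' : (e : E →L[ℂ] E).NonlinearRightInverse :=
    { toFun := e.symm
      nnnorm := (m⁻¹).toNNReal
      bound' := fun y => by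
        rw [Real.coe_toNNReal _ (by positivity), inv_mul_eq_div, le_div_iff₀ hm, mul_comm]
        simpa using hA (e.symm y)
      right_inv' := fun y => by simp }
  have hsurj := hf.surjOn_closedBall_of_nonlinearRightInverse e' hρ subset_rfl
  have hnn : ((e'.nnnorm : ℝ)⁻¹ - ((m / 2).toNNReal : ℝ)) * ρ = m / 2 * ρ := by
    have : (e'.nnnorm : ℝ) = m⁻¹ := Real.coe_toNNReal _ (by positivity)
    rw [this, Real.coe_toNNReal _ (by positivity), inv_inv]; ring
  rw [hnn] at hsurj
  obtain ⟨x, hx, hxp⟩ := hsurj (a := p) (by rwa [Metric.mem_closedBall, dist_eq_norm])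
  exact ⟨x, by rwa [Metric.mem_closedBall, dist_eq_norm] at hx, hxp⟩

end Linearization

/-! ### Lifting constant paths through a family of locally biholomorphic maps -/

/-- A family of holomorphic maps `g t` on the unit ball, `t ∈ [0, T]`, which is Lipschitz in time
with constant `b`, whose differentials are bounded below by `m`, and whose Loewner–Kufarev vector
field `v = -(dg_t)⁻¹ ∂_t g_t` points into every ball centred at `0`, for almost every `t`. -/
structure IsInwardFamily {E : Type*} [NormedAddCommGroup E] [InnerProductSpace ℂ E]
    (g : ℝ → E → E) (T m b : ℝ) : Prop where
  holomorphic : ∀ t ∈ Set.Icc 0 T, DifferentiableOn ℂ (g t) (Metric.ball 0 1)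
  bounded_below : ∀ t ∈ Set.Icc 0 T, ∀ z ∈ Metric.ball (0 : E) 1, ∀ v,
    m * ‖v‖ ≤ ‖fderiv ℂ (g t) z v‖
  lipschitz : ∀ s ∈ Set.Icc 0 T, ∀ t ∈ Set.Icc 0 T, ∀ z ∈ Metric.ball (0 : E) 1,
    ‖g t z - g s z‖ ≤ b * |t - s|
  inward : ∀ᵐ t : ℝ, t ∈ Set.Ioo 0 T → ∀ z ∈ Metric.ball (0 : E) 1, z ≠ 0 →
    DifferentiableAt ℝ (fun s => g s z) t ∧
      ∀ v, fderiv ℂ (g t) z v + deriv (fun s => g s z) t = 0 → (inner ℂ z v).re ≤ 0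

namespace IsInwardFamily

variable {E : Type*} [NormedAddCommGroup E] [InnerProductSpace ℂ E] {g : ℝ → E → E} {T m b : ℝ}

/-- Along a curve `w` on which `g_t (w t)` is constant, `w'` is the Loewner–Kufarev field. -/
theorem fderiv_apply_add_deriv_eq_zero (hg : IsInwardFamily g T m b) {w : ℝ → E} {w' p : E}
    {t R : ℝ} (hR : R < 1) (ht : t ∈ Set.Ioo 0 T) (hw : HasDerivAt w w' t)
    (hwR : ∀ᶠ x in 𝓝 t, ‖w x‖ ≤ R) (hp : ∀ᶠ x in 𝓝 t, g x (w x) = p)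
    (hd : DifferentiableAt ℝ (fun s => g s (w t)) t) :
    fderiv ℂ (g t) (w t) w' + deriv (fun s => g s (w t)) t = 0 := by
  have htI : t ∈ Set.Icc 0 T := Set.Ioo_subset_Icc_self ht
  have hwt : ‖w t‖ ≤ R := hwR.self_of_nhds
  have hwb : w t ∈ Metric.ball (0 : E) 1 := by rw [mem_ball_zero_iff]; linarith
  have h1 : HasDerivAt (fun x => g t (w x)) (fderiv ℂ (g t) (w t) w') t := by
    have := ((hg.holomorphic t htI).differentiableAt
      (Metric.isOpen_ball.mem_nhds hwb)).hasFDerivAt.restrictScalars ℝ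
    exact this.comp_hasDerivAt t hw
  have h2 : HasDerivAt (fun x => g x (w t)) (deriv (fun s => g s (w t)) t) t := hd.hasDerivAt
  -- The mixed second difference is quadratically small, because `g x - g t` is a holomorphic map
  -- bounded by `b * |x - t|`.
  have h3 : HasDerivAt (fun x => (g x (w x) - g t (w x)) - (g x (w t) - g t (w t))) 0 t := by
    have hO : (fun x => (g x (w x) - g t (w x)) - (g x (w t) - g t (w t))) =O[𝓝 t]
        fun x => ‖x - t‖ * ‖w x - w t‖ := by
      refine Asymptotics.IsBigO.of_bound (2 * b / (1 - R)) ?_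
      filter_upwards [hwR, Ioo_mem_nhds ht.1 ht.2] with x hx hxI
      have hxI' : x ∈ Set.Icc 0 T := Set.Ioo_subset_Icc_self hxI
      have := norm_sub_le_of_norm_le_on_ball (f := fun z => g x z - g t z) (r := R) (η := 1 - R)
        (M := b * |x - t|) (by linarith)
        (by rw [add_sub_cancel]; exact (hg.holomorphic x hxI').sub (hg.holomorphic t htI))
        (by rw [add_sub_cancel]; exact fun z hz => hg.lipschitz t htI x hxI' z hz) hx hwt
      refine this.trans (le_of_eq ?_)
      rw [norm_mul, norm_norm, norm_norm, Real.norm_eq_abs]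
      ring
    have hO2 : (fun x => ‖x - t‖ * ‖w x - w t‖) =O[𝓝 t] fun x => ‖x - t‖ ^ 2 := by
      simp only [pow_two]
      exact (Asymptotics.isBigO_refl _ _).mul hw.isBigO_sub.norm_norm
    have := (hO.trans hO2).hasFDerivAt (𝕜 := ℝ) one_lt_two
    simpa using this.hasDerivAt
  have h4 := (h3.add h1).add h2
  have h5 : HasDerivAt (fun x => (((g x (w x) - g t (w x)) - (g x (w t) - g t (w t))) + g t (w x))
      + g x (w t)) 0 t := by
    refine (hasDerivAt_const t (p + g t (w t))).congr_of_eventuallyEq ?_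
    filter_upwards [hp] with x hx
    rw [← hx]; abel
  have := h4.unique h5
  rwa [zero_add] at this

variable [FiniteDimensional ℂ E]

/-- Curves on which `g_t (w t)` is constant move towards the origin. -/
theorem norm_le_of_apply_eq_const (hg : IsInwardFamily g T m b) {w : ℝ → E} {p : E}
    {s t R : ℝ} {K : NNReal} (hs : 0 ≤ s) (hst : s ≤ t) (htT : t ≤ T) (hR : R < 1)
    (hw : LipschitzOnWith K w (Set.Icc s t)) (hwR : ∀ x ∈ Set.Icc s t, ‖w x‖ ≤ R)
    (hp : ∀ x ∈ Set.Icc s t, g x (w x) = p) : ‖w t‖ ≤ ‖w s‖ := by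
  have hu : LipschitzOnWith (2 * K) (fun x => ‖w x‖ ^ 2) (Set.Icc s t) := by
    refine LipschitzOnWith.of_dist_le_mul fun x hx y hy => ?_
    have h1 := hw.dist_le_mul x hx y hy
    have h2 := abs_norm_sub_norm_le (w x) (w y)
    rw [dist_eq_norm] at h1
    rw [Real.dist_eq, sq_sub_sq, abs_mul, abs_of_nonneg (by positivity)]
    push_cast
    have h3 : ‖w x‖ + ‖w y‖ ≤ 2 := by linarith [hwR x hx, hwR y hy]
    calc (‖w x‖ + ‖w y‖) * |‖w x‖ - ‖w y‖| ≤ 2 * (K * dist x y) := by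
          gcongr
          exact h2.trans h1
      _ = 2 * K * dist x y := by ring
  have hmain := sub_le_mul_sub_of_ae_deriv_le (C := 0) hst hu (by
    filter_upwards [hw.ae_differentiableWithinAt_of_mem_real, hg.inward] with x hx1 hx2 hx _
    have hxn : Set.Icc s t ∈ 𝓝 x := Icc_mem_nhds hx.1 hx.2
    have hxT : x ∈ Set.Ioo 0 T := ⟨by linarith [hx.1], by linarith [hx.2]⟩
    have hwd : HasDerivAt w (deriv w x) x :=
      ((hx1 (Set.Ioo_subset_Icc_self hx)).differentiableAt hxn).hasDerivAt
    let _ : InnerProductSpace ℝ E := InnerProductSpace.complexToReal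
    have hsq : HasDerivAt (fun x => ‖w x‖ ^ 2) (2 * inner ℝ (w x) (deriv w x)) x := hwd.norm_sq
    rw [hsq.deriv, real_inner_eq_re_inner ℂ]
    rcases eq_or_ne (w x) 0 with h0 | h0
    · simp [h0]
    have hwb : w x ∈ Metric.ball (0 : E) 1 := by
      rw [mem_ball_zero_iff]; linarith [hwR x (Set.Ioo_subset_Icc_self hx)]
    obtain ⟨hd, hin⟩ := hx2 hxT _ hwb h0
    have := hin _ (hg.fderiv_apply_add_deriv_eq_zero hR hxT hwd
      (by filter_upwards [hxn] with y hy using hwR y hy)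
      (by filter_upwards [hxn] with y hy using hp y hy) hd)
    exact mul_nonpos_of_nonneg_of_nonpos zero_le_two this)
  rw [zero_mul, sub_nonpos] at hmain
  exact (sq_le_sq₀ (norm_nonneg _) (norm_nonneg _)).1 hmain

theorem exists_norm_le (hg : IsInwardFamily g T m b) (hT : 0 ≤ T) (hb : 0 ≤ b) {R : ℝ}
    (hR : R < 1) :
    ∃ M, 0 ≤ M ∧ ∀ t ∈ Set.Icc 0 T, ∀ z : E, ‖z‖ ≤ R → ‖g t z‖ ≤ M := by
  have h0 : (0 : ℝ) ∈ Set.Icc 0 T := ⟨le_rfl, hT⟩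
  have : ProperSpace E := FiniteDimensional.proper ℂ E
  obtain ⟨M, hM⟩ := (isCompact_closedBall (0 : E) R).exists_bound_of_continuousOn
    ((hg.holomorphic 0 h0).continuousOn.mono (Metric.closedBall_subset_ball hR))
  refine ⟨|M| + b * T, by positivity, fun t ht z hz => ?_⟩
  have h1 := hM z (by simpa using hz)
  have h2 := hg.lipschitz 0 h0 t ht z (by rw [mem_ball_zero_iff]; linarith)
  rw [sub_zero, abs_of_nonneg ht.1] at h2
  calc ‖g t z‖ = ‖g 0 z + (g t z - g 0 z)‖ := by congr 1; abel
    _ ≤ ‖g 0 z‖ + ‖g t z - g 0 z‖ := norm_add_le _ _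
    _ ≤ |M| + b * T := add_le_add (h1.trans (le_abs_self M))
        (h2.trans (mul_le_mul_of_nonneg_left ht.2 hb))

theorem exists_approximatesLinearOn (hg : IsInwardFamily g T m b) (hT : 0 ≤ T) (hb : 0 ≤ b)
    (hm : 0 < m) {r : ℝ} (hr : r < 1) :
    ∃ ρ, 0 < ρ ∧ r + ρ < 1 ∧ ∀ t ∈ Set.Icc 0 T, ∀ z : E, ‖z‖ ≤ r →
      ApproximatesLinearOn (g t) (fderiv ℂ (g t) z) (Metric.closedBall z ρ) (m / 2).toNNReal := by
  set η := (1 - r) / 4 with hη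
  have hηp : 0 < η := by linarith
  obtain ⟨M, hM0, hM⟩ := hg.exists_norm_le hT hb (R := r + η + η + η) (by linarith)
  set L := 4 * M / η ^ 2 with hL
  have hL0 : 0 ≤ L := by positivity
  have hρ : L * min η (m / 2 / (L + 1)) ≤ m / 2 := by
    calc L * min η (m / 2 / (L + 1)) ≤ (L + 1) * (m / 2 / (L + 1)) := by
          gcongr
          · linarith
          · exact min_le_right _ _
      _ = m / 2 := by field_simp
  refine ⟨min η (m / 2 / (L + 1)), by positivity, ?_, fun t ht z hz => ?_⟩
  · linarith [min_le_left η (m / 2 / (L + 1))]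
  · refine approximatesLinearOn_of_norm_le_on_ball hηp ((hg.holomorphic t ht).mono ?_)
      (fun x hx => hM t ht x (by rw [mem_ball_zero_iff] at hx; exact hx.le)) hM0
      (min_le_left _ _) ?_ hz
    · exact Metric.ball_subset_ball (by linarith)
    · rwa [Real.coe_toNNReal _ (by positivity)]

/-- The lifting statement for time steps of a length `δ` that depends only on the radius `r`. -/
theorem exists_step (hg : IsInwardFamily g T m b) (hT : 0 ≤ T) (hb : 0 ≤ b) (hm : 0 < m) {r : ℝ}
    (hr : r < 1) :
    ∃ ρ δ : ℝ, 0 < δ ∧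
      (∀ s ∈ Set.Icc 0 T, ∀ x y : E, ‖x‖ ≤ r → ‖y‖ ≤ r → ‖x - y‖ ≤ 2 * ρ → g s x = g s y → x = y) ∧
      ∀ s t : ℝ, 0 ≤ s → s ≤ t → t ≤ T → t - s ≤ δ → ∀ z : E, ‖z‖ ≤ r →
        ∃ w, ‖w‖ ≤ ‖z‖ ∧ ‖w - z‖ ≤ ρ ∧ g t w = g s z := by
  obtain ⟨ρ, hρ, hrρ, happ⟩ := hg.exists_approximatesLinearOn hT hb hm hr
  have hin : ∀ z : E, ‖z‖ ≤ r → z ∈ Metric.ball (0 : E) 1 := fun z hz => by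
    rw [mem_ball_zero_iff]; linarith
  refine ⟨ρ / 2, m / 2 * (ρ / 2) / (b + 1), by positivity, ?_, ?_⟩
  · intro s hs x y hx hy hxy hgxy
    have := (happ s hs x hx).mul_norm_sub_le_of_bounded_below (hg.bounded_below s hs x (hin x hx))
      hm (x := x) (y := y) (Metric.mem_closedBall_self hρ.le)
      (by rw [Metric.mem_closedBall, dist_eq_norm, norm_sub_rev]; linarith)
    rw [hgxy, sub_self, norm_zero] at this
    exact sub_eq_zero.1 (norm_le_zero_iff.1 (nonpos_of_mul_nonpos_right this (by positivity)))
  · intro s t hs hst htT hts z hz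
    have hI : ∀ x ∈ Set.Icc s t, x ∈ Set.Icc 0 T := fun x hx =>
      ⟨hs.trans hx.1, hx.2.trans htT⟩
    have hsI : s ∈ Set.Icc s t := ⟨le_rfl, hst⟩
    have htI : t ∈ Set.Icc s t := ⟨hst, le_rfl⟩
    have hex : ∀ x ∈ Set.Icc s t, ∃ w, ‖w - z‖ ≤ ρ / 2 ∧ g x w = g s z := by
      intro x hx
      refine ApproximatesLinearOn.exists_eq_of_bounded_below hm
        (hg.bounded_below x (hI x hx) z (hin z hz)) ((happ x (hI x hx) z hz).mono_set
          (Metric.closedBall_subset_closedBall (by linarith))) (by positivity) ?_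
      have h1 := hg.lipschitz x (hI x hx) s (hI s hsI) z (hin z hz)
      have h2 : |s - x| ≤ m / 2 * (ρ / 2) / (b + 1) := by
        rw [abs_sub_comm, abs_of_nonneg (by linarith [hx.1])]; linarith [hx.2]
      calc ‖g s z - g x z‖ ≤ b * |s - x| := h1
        _ ≤ (b + 1) * (m / 2 * (ρ / 2) / (b + 1)) := by gcongr; linarith
        _ = m / 2 * (ρ / 2) := by field_simp
    choose! w hw using hex
    have hwball : ∀ x ∈ Set.Icc s t, w x ∈ Metric.closedBall z ρ := fun x hx => by
      rw [Metric.mem_closedBall, dist_eq_norm]; linarith [(hw x hx).1]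
    have hwR : ∀ x ∈ Set.Icc s t, ‖w x‖ ≤ r + ρ := fun x hx => by
      have h1 := (hw x hx).1
      have h2 := norm_sub_norm_le (w x) z
      linarith
    have hws : w s = z := by
      have := (happ s (hI s hsI) z hz).mul_norm_sub_le_of_bounded_below
        (hg.bounded_below s (hI s hsI) z (hin z hz)) hm (hwball s hsI)
        (Metric.mem_closedBall_self hρ.le)
      rw [(hw s hsI).2, sub_self, norm_zero] at this
      exact sub_eq_zero.1 (norm_le_zero_iff.1 (nonpos_of_mul_nonpos_right this (by positivity)))
    have hlip : LipschitzOnWith (2 * b / m).toNNReal w (Set.Icc s t) := by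
      refine LipschitzOnWith.of_dist_le_mul fun x hx y hy => ?_
      rw [Real.coe_toNNReal _ (by positivity), dist_eq_norm, Real.dist_eq]
      have h1 := (happ x (hI x hx) z hz).mul_norm_sub_le_of_bounded_below
        (hg.bounded_below x (hI x hx) z (hin z hz)) hm (hwball x hx) (hwball y hy)
      have h2 := hg.lipschitz x (hI x hx) y (hI y hy) (w y)
        (by rw [mem_ball_zero_iff]; linarith [hwR y hy])
      rw [(hw x hx).2, ← (hw y hy).2] at h1
      rw [abs_sub_comm] at h2
      calc ‖w x - w y‖ = 2 / m * (m / 2 * ‖w x - w y‖) := by field_simp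
        _ ≤ 2 / m * (b * |x - y|) := by
            have := h1.trans h2
            gcongr
        _ = 2 * b / m * |x - y| := by ring
    have hle := hg.norm_le_of_apply_eq_const hs hst htT hrρ hlip hwR (fun x hx => (hw x hx).2)
    rw [hws] at hle
    exact ⟨w t, hle, (hw t htI).1, (hw t htI).2⟩

theorem exists_lift (hg : IsInwardFamily g T m b) (hT : 0 ≤ T) (hb : 0 ≤ b) (hm : 0 < m)
    {s t : ℝ} (hs : 0 ≤ s) (hst : s ≤ t) (htT : t ≤ T) {z : E} (hz : z ∈ Metric.ball (0 : E) 1) :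
    ∃ w, ‖w‖ ≤ ‖z‖ ∧ g t w = g s z := by
  rw [mem_ball_zero_iff] at hz
  obtain ⟨ρ, δ, hδ, -, hstep⟩ := hg.exists_step hT hb hm hz
  have key : ∀ k : ℕ, ∀ s, 0 ≤ s → s ≤ t → t - s ≤ k * δ → ∀ x : E, ‖x‖ ≤ ‖z‖ →
      ∃ w, ‖w‖ ≤ ‖x‖ ∧ g t w = g s x := by
    intro k
    induction k with
    | zero =>
      intro s _ hst hts x hx
      have : s = t := by simp at hts; linarith
      exact ⟨x, le_rfl, by rw [this]⟩
    | succ k ih =>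
      intro s hs hst hts x hx
      push_cast at hts
      obtain ⟨w, hw, -, hgw⟩ := hstep s (min (s + δ) t) hs (le_min (by linarith) hst)
        ((min_le_right _ _).trans htT) (by linarith [min_le_left (s + δ) t]) x hx
      obtain ⟨w', hw', hgw'⟩ := ih (min (s + δ) t) (le_min (by linarith) (by linarith))
        (min_le_right _ _) (by
          rcases min_cases (s + δ) t with ⟨h, -⟩ | ⟨h, -⟩ <;> rw [h]
          · linarith
          · rw [sub_self]; positivity) w (hw.trans hx)
      exact ⟨w', hw'.trans hw, hgw'.trans hgw⟩
  obtain ⟨k, hk⟩ := exists_nat_ge ((t - s) / δ)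
  exact key k s hs hst ((div_le_iff₀ hδ).1 hk) z le_rfl

/-- Injectivity propagates backwards in time from `T`: two points with the same image have, after
a short time, lifts which coincide, so they are close to each other. -/
theorem injOn (hg : IsInwardFamily g T m b) (hT : 0 ≤ T) (hb : 0 ≤ b) (hm : 0 < m)
    (hinj : Set.InjOn (g T) (Metric.ball 0 1)) {s : ℝ} (hs : s ∈ Set.Icc 0 T) :
    Set.InjOn (g s) (Metric.ball 0 1) := by
  intro x₀ hx₀ y₀ hy₀ hxy₀
  rw [mem_ball_zero_iff] at hx₀ hy₀
  set r := max ‖x₀‖ ‖y₀‖ with hr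
  have hr1 : r < 1 := max_lt hx₀ hy₀
  obtain ⟨ρ, δ, hδ, hloc, hstep⟩ := hg.exists_step hT hb hm hr1
  have key : ∀ k : ℕ, ∀ s, 0 ≤ s → s ≤ T → T - s ≤ k * δ → ∀ x y : E, ‖x‖ ≤ r → ‖y‖ ≤ r →
      g s x = g s y → x = y := by
    intro k
    induction k with
    | zero =>
      intro s _ hst hts x y hx hy hxy
      obtain rfl : s = T := by simp at hts; linarith
      exact hinj (by rw [mem_ball_zero_iff]; linarith) (by rw [mem_ball_zero_iff]; linarith) hxy
    | succ k ih =>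
      intro s hs hst hts x y hx hy hxy
      push_cast at hts
      have h1 : s ≤ min (s + δ) T := le_min (by linarith) hst
      have h2 : min (s + δ) T - s ≤ δ := by linarith [min_le_left (s + δ) T]
      obtain ⟨w, hw, hwx, hgw⟩ := hstep s _ hs h1 (min_le_right _ _) h2 x hx
      obtain ⟨w', hw', hwy, hgw'⟩ := hstep s _ hs h1 (min_le_right _ _) h2 y hy
      obtain rfl := ih (min (s + δ) T) (hs.trans h1) (min_le_right _ _) (by
          rcases min_cases (s + δ) T with ⟨h, -⟩ | ⟨h, -⟩ <;> rw [h]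
          · linarith
          · rw [sub_self]; positivity) w w' (hw.trans hx) (hw'.trans hy)
          (hgw.trans (hxy.trans hgw'.symm))
      refine hloc s ⟨hs, hst⟩ x y hx hy ?_ hxy
      calc ‖x - y‖ = ‖(w - y) - (w - x)‖ := by congr 1; abel
        _ ≤ ‖w - y‖ + ‖w - x‖ := norm_sub_le _ _
        _ ≤ 2 * ρ := by linarith
  obtain ⟨k, hk⟩ := exists_nat_ge ((T - s) / δ)
  exact key k s hs.1 hs.2 ((div_le_iff₀ hδ).1 hk) x₀ y₀ (le_max_left _ _) (le_max_right _ _) hxy₀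

/-- The transition map `ψ = g_t⁻¹ ∘ g_s`. -/
theorem exists_transition (hg : IsInwardFamily g T m b) (hT : 0 ≤ T) (hb : 0 ≤ b) (hm : 0 < m)
    (hinj : Set.InjOn (g T) (Metric.ball 0 1)) {s t : ℝ} (hs : 0 ≤ s) (hst : s ≤ t)
    (htT : t ≤ T) :
    ∃ ψ : E → E, DifferentiableOn ℂ ψ (Metric.ball 0 1) ∧
      Set.MapsTo ψ (Metric.ball 0 1) (Metric.ball 0 1) ∧ ψ 0 = 0 ∧
        ∀ z ∈ Metric.ball (0 : E) 1, g s z = g t (ψ z) := by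
  have htI : t ∈ Set.Icc 0 T := ⟨hs.trans hst, htT⟩
  have hsI : s ∈ Set.Icc 0 T := ⟨hs, hst.trans htT⟩
  choose! ψ hψ using fun (z : E) (hz : z ∈ Metric.ball (0 : E) 1) =>
    hg.exists_lift hT hb hm hs hst htT hz
  have hmaps : Set.MapsTo ψ (Metric.ball 0 1) (Metric.ball 0 1) := fun z hz => by
    rw [mem_ball_zero_iff] at hz ⊢
    exact (hψ z (by rwa [mem_ball_zero_iff])).1.trans_lt hz
  refine ⟨ψ, fun z hz => ?_, hmaps, ?_, fun z hz => (hψ z hz).2.symm⟩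
  · refine DifferentiableAt.differentiableWithinAt ?_
    have hz' := hmaps hz
    have hgz : DifferentiableAt ℂ (g s) z :=
      (hg.holomorphic s hsI).differentiableAt (Metric.isOpen_ball.mem_nhds hz)
    have hcont : ContinuousAt ψ z := by
      rw [Metric.continuousAt_iff']
      intro ε hε
      have hz'' := hz'
      rw [mem_ball_zero_iff] at hz''
      obtain ⟨ρ, hρ, hrρ, happ⟩ := hg.exists_approximatesLinearOn hT hb hm hz''
      have hσ : 0 < min ρ (ε / 2) := by positivity
      have hev := Metric.continuousAt_iff'.1 hgz.continuousAt (m / 2 * min ρ (ε / 2))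
        (by positivity)
      filter_upwards [hev, Metric.isOpen_ball.mem_nhds hz] with x hx hxb
      obtain ⟨y, hy, hgy⟩ := ApproximatesLinearOn.exists_eq_of_bounded_below hm
        (hg.bounded_below t htI _ hz') ((happ t htI _ le_rfl).mono_set
          (Metric.closedBall_subset_closedBall (min_le_left _ (ε / 2)))) hσ.le (p := g s x)
        (by rw [(hψ z hz).2, ← dist_eq_norm]; exact hx.le)
      have hyb : y ∈ Metric.ball (0 : E) 1 := by
        rw [mem_ball_zero_iff]
        have := norm_sub_norm_le y (ψ z)
        linarith [min_le_left ρ (ε / 2)]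
      have : ψ x = y := hg.injOn hT hb hm hinj htI (hmaps hxb) hyb ((hψ x hxb).2.trans hgy.symm)
      rw [this, dist_eq_norm]
      linarith [min_le_right ρ (ε / 2)]
    obtain ⟨e, he⟩ := exists_continuousLinearEquiv_of_bounded_below hm
      (hg.bounded_below t htI _ hz')
    have hgt : HasFDerivAt (g t) (e : E →L[ℂ] E) (ψ z) := by
      rw [he]
      exact ((hg.holomorphic t htI).differentiableAt
        (Metric.isOpen_ball.mem_nhds hz')).hasFDerivAt
    refine (HasFDerivAt.of_comp_of_isEmbedding (h := g s)
      (g' := (e.symm : E →L[ℂ] E).comp (fderiv ℂ (g s) z)) hcont hgt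
      e.toHomeomorph.isEmbedding ?_ ?_).differentiableAt
    · have : (e : E →L[ℂ] E).comp ((e.symm : E →L[ℂ] E).comp (fderiv ℂ (g s) z))
          = fderiv ℂ (g s) z := by ext v; simp
      rw [this]
      exact hgz.hasFDerivAt
    · filter_upwards [Metric.isOpen_ball.mem_nhds hz] with x hx using (hψ x hx).2
  · have := (hψ 0 (by simp)).1
    simpa using this

end IsInwardFamily

namespace Loewner

variable {n : ℕ} {f : ℝ → Cn n → Cn n} {T b : ℝ}

/-! ### Regularity of a Loewner chain in time -/

namespace IsNormalizedSubordinationChain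

theorem fderiv_transition (hf : IsNormalizedSubordinationChain f) {s t : ℝ} (hs : 0 ≤ s)
    (hst : s ≤ t) {φ : Cn n → Cn n} (hφ : DifferentiableOn ℂ φ (unitBall n)) (h0 : φ 0 = 0)
    (hfφ : ∀ z ∈ unitBall n, f s z = f t (φ z)) :
    fderiv ℂ φ 0 = ((Real.exp (s - t) : ℝ) : ℂ) • ContinuousLinearMap.id ℂ (Cn n) := by
  have hb : unitBall n ∈ 𝓝 (0 : Cn n) := Metric.ball_mem_nhds _ one_pos
  have h1 : HasFDerivAt (f t) (fderiv ℂ (f t) 0) (φ 0) := by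
    rw [h0]
    exact ((hf.holomorphic t (hs.trans hst)).differentiableAt hb).hasFDerivAt
  have h2 := h1.comp (0 : Cn n) (hφ.differentiableAt hb).hasFDerivAt
  have h3 : f s =ᶠ[𝓝 0] f t ∘ φ := by filter_upwards [hb] with z hz using hfφ z hz
  have h4 := hf.fderiv_zero s hs
  rw [h3.fderiv_eq, h2.fderiv, hf.fderiv_zero t (hs.trans hst)] at h4
  ext1 v
  have h5 := congrArg (fun A : Cn n →L[ℂ] Cn n => ((Real.exp (-t) : ℝ) : ℂ) • A v) h4
  simp only [ContinuousLinearMap.comp_apply, _root_.smul_apply,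
    ContinuousLinearMap.id_apply, smul_smul, ← Complex.ofReal_mul, ← Real.exp_add] at h5
  rw [neg_add_cancel, Real.exp_zero, Complex.ofReal_one, one_smul, add_comm (-t) s,
    ← sub_eq_add_neg] at h5
  simpa using h5

theorem exists_norm_le (hf : IsNormalizedSubordinationChain f) (hT : 0 ≤ T) {R : ℝ} (hR : R < 1) :
    ∃ M, ∀ t ∈ Set.Icc 0 T, ∀ z : Cn n, ‖z‖ ≤ R → ‖f t z‖ ≤ M := by
  obtain ⟨M, hM⟩ := (isCompact_closedBall (0 : Cn n) R).exists_bound_of_continuousOn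
    ((hf.holomorphic T hT).continuousOn.mono (Metric.closedBall_subset_ball hR))
  refine ⟨M, fun t ht z hz => ?_⟩
  obtain ⟨φ, hφ, hmaps, h0, hfφ⟩ := hf.subordinate t T ht.1 ht.2
  have hz1 : ‖z‖ < 1 := by linarith
  rw [hfφ z (by rwa [mem_ball_zero_iff])]
  refine hM _ ?_
  rw [mem_closedBall_zero_iff]
  exact (Complex.norm_le_norm_of_mapsTo_ball hφ
    (hmaps.mono_right Metric.ball_subset_closedBall) h0 hz1).trans hz

/-- Normalized subordination chains are Lipschitz in time, locally uniformly in the ball. -/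
theorem exists_norm_sub_le (hf : IsNormalizedSubordinationChain f) (hT : 0 ≤ T) {R : ℝ}
    (hR : R < 1) :
    ∃ K : NNReal, ∀ z : Cn n, ‖z‖ ≤ R → LipschitzOnWith K (fun t => f t z) (Set.Icc 0 T) := by
  set η := (1 - R) / 2 with hη
  have hηp : 0 < η := by linarith
  obtain ⟨M, hM⟩ := hf.exists_norm_le hT (R := R + η) (by linarith)
  set K := 2 * |M| / η * (8 / (1 - R) ^ 2) with hK
  have hK0 : 0 ≤ K := by positivity
  have key : ∀ z : Cn n, ‖z‖ ≤ R → ∀ s ∈ Set.Icc 0 T, ∀ t ∈ Set.Icc 0 T, s < t →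
      ‖f s z - f t z‖ ≤ K * (t - s) := by
    intro z hz s hs t ht hst
    obtain ⟨φ, hφ, hmaps, h0, hfφ⟩ := hf.subordinate s t hs.1 hst.le
    have hz1 : ‖z‖ < 1 := by linarith
    have hφz : ‖φ z‖ ≤ R := (Complex.norm_le_norm_of_mapsTo_ball hφ
      (hmaps.mono_right Metric.ball_subset_closedBall) h0 hz1).trans hz
    rw [hfφ z (by rwa [mem_ball_zero_iff])]
    have h1 := norm_sub_le_of_norm_le_on_ball (M := |M|) hηp
      ((hf.holomorphic t ht.1).mono (Metric.ball_subset_ball (by linarith)))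
      (fun x hx => (hM t ht x (by rw [mem_ball_zero_iff] at hx; exact hx.le)).trans (le_abs_self M))
      hφz hz
    have h2 := norm_sub_apply_le_of_fderiv_eq_smul hφ hmaps h0
      (hf.fderiv_transition hs.1 hst.le hφ h0 hfφ) (by rw [Real.exp_lt_one_iff]; linarith) hR hz
    rw [norm_sub_rev] at h2
    have h3 : 1 - Real.exp (s - t) ≤ t - s := by linarith [Real.add_one_le_exp (s - t)]
    calc ‖f t (φ z) - f t z‖ ≤ 2 * |M| / η * ‖φ z - z‖ := h1
      _ ≤ 2 * |M| / η * (8 / (1 - R) ^ 2 * (t - s)) := by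
          have : 8 / (1 - R) ^ 2 * (1 - Real.exp (s - t)) ≤ 8 / (1 - R) ^ 2 * (t - s) := by gcongr
          gcongr
          exact h2.trans this
      _ = K * (t - s) := by rw [hK]; ring
  refine ⟨K.toNNReal, fun z hz => LipschitzOnWith.of_dist_le_mul fun s hs t ht => ?_⟩
  rw [Real.coe_toNNReal _ hK0, dist_eq_norm, Real.dist_eq]
  rcases lt_trichotomy s t with h | rfl | h
  · rw [abs_sub_comm, abs_of_pos (by linarith)]; exact key z hz s hs t ht h
  · simp
  · rw [norm_sub_rev, abs_of_pos (by linarith)]; exact key z hz t ht s hs h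

/-- A uniform bound on `∂_t f_t` makes the chain Lipschitz in time up to the boundary of the ball;
the factor `‖z‖` comes from the Schwarz lemma. -/
theorem norm_sub_le_of_ae_norm_deriv_le (hf : IsNormalizedSubordinationChain f) (hT : 0 ≤ T)
    (hb0 : 0 ≤ b)
    (hb : ∀ᵐ t : ℝ, t ∈ Set.Ico 0 T → ∀ z ∈ unitBall n, ‖deriv (fun s => f s z) t‖ ≤ b)
    {s t : ℝ} (hs : s ∈ Set.Icc 0 T) (ht : t ∈ Set.Icc 0 T) {z : Cn n} (hz : z ∈ unitBall n) :
    ‖f t z - f s z‖ ≤ b * |t - s| * ‖z‖ := by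
  have key : ∀ s ∈ Set.Icc 0 T, ∀ t ∈ Set.Icc 0 T, s ≤ t → ∀ z ∈ unitBall n,
      ‖f t z - f s z‖ ≤ b * (t - s) := by
    intro s hs t ht hst z hz
    rw [mem_ball_zero_iff] at hz
    obtain ⟨K, hK⟩ := hf.exists_norm_sub_le hT hz
    refine norm_sub_le_mul_sub_of_ae_norm_deriv_le (w := fun t => f t z) hst hb0
      ((hK z le_rfl).mono (Set.Icc_subset_Icc hs.1 ht.2)) ?_
    filter_upwards [hb] with x hx hxI
    exact hx ⟨hs.1.trans hxI.1.le, hxI.2.trans_le ht.2⟩ z (by rwa [mem_ball_zero_iff])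
  have key' : ∀ z ∈ unitBall n, ‖f t z - f s z‖ ≤ b * |t - s| := by
    intro z hz
    rcases le_total s t with h | h
    · rw [abs_of_nonneg (by linarith)]; exact key s hs t ht h z hz
    · rw [norm_sub_rev, abs_sub_comm, abs_of_nonneg (by linarith)]; exact key t ht s hs h z hz
  have h0 : f t 0 - f s 0 = 0 := by rw [hf.map_zero t ht.1, hf.map_zero s hs.1, sub_zero]
  have := Complex.dist_le_div_mul_dist_of_mapsTo_ball (f := fun z => f t z - f s z)
    (R₂ := b * |t - s|) ((hf.holomorphic t ht.1).sub (hf.holomorphic s hs.1)) (fun x hx => by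
      simpa [h0] using key' x hx) hz
  simpa [h0] using this

theorem norm_deriv_le_mul_norm (hf : IsNormalizedSubordinationChain f) (hT : 0 ≤ T) (hb0 : 0 ≤ b)
    (hb : ∀ᵐ t : ℝ, t ∈ Set.Ico 0 T → ∀ z ∈ unitBall n, ‖deriv (fun s => f s z) t‖ ≤ b)
    {t : ℝ} (ht : t ∈ Set.Ioo 0 T) {z : Cn n} (hz : z ∈ unitBall n) :
    ‖deriv (fun s => f s z) t‖ ≤ b * ‖z‖ := by
  refine norm_deriv_le_of_lip' (by positivity) ?_
  filter_upwards [Ioo_mem_nhds ht.1 ht.2] with x hx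
  refine (hf.norm_sub_le_of_ae_norm_deriv_le hT hb0 hb (Set.Ioo_subset_Icc_self ht)
    (Set.Ioo_subset_Icc_self hx) hz).trans (le_of_eq ?_)
  rw [Real.norm_eq_abs]
  ring

end IsNormalizedSubordinationChain

theorem mul_norm_le_of_le_minStretch {A : Cn n →L[ℂ] Cn n} {a : ℝ} (ha : a ≤ minStretch A)
    (v : Cn n) : a * ‖v‖ ≤ ‖A v‖ := by
  rcases eq_or_ne v 0 with rfl | hv
  · simp
  have hp : 0 < ‖v‖ := norm_pos_iff.2 hv
  have hmem : ((‖v‖ : ℂ)⁻¹) • v ∈ Metric.sphere (0 : Cn n) 1 := by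
    rw [mem_sphere_zero_iff_norm, norm_smul]
    simp [hp.ne']
  have h1 : minStretch A ≤ ‖A (((‖v‖ : ℂ)⁻¹) • v)‖ :=
    ciInf_le (f := fun v : Metric.sphere (0 : Cn n) 1 => ‖A v‖)
      ⟨0, by rintro _ ⟨w, rfl⟩; exact norm_nonneg _⟩ ⟨_, hmem⟩
  rw [map_smul, norm_smul, norm_inv, Complex.norm_real, norm_norm, inv_mul_eq_div,
    le_div_iff₀ hp] at h1
  exact (mul_le_mul_of_nonneg_right ha hp.le).trans h1

/-- The lower bound on the differentials persists at the endpoint `T`, because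
`d(f_t)_z → d(f_T)_z` as `t → T`. -/
theorem mul_norm_le_norm_fderiv_of_mem_Icc (hf : IsNormalizedSubordinationChain f) (hT : 0 < T)
    (hb0 : 0 ≤ b)
    (hb : ∀ᵐ t : ℝ, t ∈ Set.Ico 0 T → ∀ z ∈ unitBall n, ‖deriv (fun s => f s z) t‖ ≤ b) {a : ℝ}
    (ha : ∀ t ∈ Set.Ico 0 T, ∀ z ∈ unitBall n, a ≤ minStretch (fderiv ℂ (f t) z))
    {t : ℝ} (ht : t ∈ Set.Icc 0 T) {z : Cn n} (hz : z ∈ unitBall n) (v : Cn n) :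
    a * ‖v‖ ≤ ‖fderiv ℂ (f t) z v‖ := by
  rcases ht.2.lt_or_eq with hlt | rfl
  · exact mul_norm_le_of_le_minStretch (ha t ⟨ht.1, hlt⟩ z hz) v
  have hz' : 0 < 1 - ‖z‖ := by
    have := mem_ball_zero_iff.1 hz
    linarith
  have hsub : Metric.ball z (1 - ‖z‖) ⊆ unitBall n :=
    Metric.ball_subset_ball' (by simp)
  have hd : ∀ s ∈ Set.Icc 0 t, DifferentiableAt ℂ (f s) z := fun s hs =>
    (hf.holomorphic s hs.1).differentiableAt (Metric.isOpen_ball.mem_nhds hz)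
  have hev : ∀ᶠ s in 𝓝[<] t,
      a * ‖v‖ ≤ ‖fderiv ℂ (f t) z v‖ + 2 * (b * |t - s|) / (1 - ‖z‖) * ‖v‖ := by
    filter_upwards [Ioo_mem_nhdsLT hT] with s hs
    have hs' : s ∈ Set.Icc 0 t := Set.Ioo_subset_Icc_self hs
    have h1 := norm_fderiv_le_of_norm_le_on_ball (f := fun z => f t z - f s z)
      (M := b * |t - s|) hz'
      (((hf.holomorphic t ht.1).sub (hf.holomorphic s hs'.1)).mono hsub) (fun x hx => by
        refine (hf.norm_sub_le_of_ae_norm_deriv_le hT.le hb0 hb hs' ht (hsub hx)).trans ?_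
        have := mem_ball_zero_iff.1 (hsub hx)
        exact mul_le_of_le_one_right (by positivity) this.le)
    rw [fderiv_fun_sub (hd t ht) (hd s hs')] at h1
    have h2 := (fderiv ℂ (f t) z - fderiv ℂ (f s) z).le_of_opNorm_le h1 v
    have h3 := mul_norm_le_of_le_minStretch (ha s ⟨hs'.1, hs.2⟩ z hz) v
    rw [_root_.sub_apply, norm_sub_rev] at h2
    have h4 := norm_sub_norm_le (fderiv ℂ (f s) z v) (fderiv ℂ (f t) z v)
    linarith
  refine ge_of_tendsto (b := a * ‖v‖) (x := 𝓝[<] t) ?_ hev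
  have hcont : Continuous fun s : ℝ =>
      ‖fderiv ℂ (f t) z v‖ + 2 * (b * |t - s|) / (1 - ‖z‖) * ‖v‖ := by fun_prop
  have := (hcont.tendsto t).mono_left (nhdsWithin_le_nhds (s := Set.Iio t))
  simpa using this

/-! ### The varied family -/

theorem variationWeight_of_le (hT : 0 < T) {ε t : ℝ} (ht : t ≤ T) :
    variationWeight ε T t = ε * (1 - t / T) := by
  unfold variationWeight
  split_ifs with h
  · rfl
  · obtain rfl : t = T := le_antisymm ht (not_lt.1 h)
    rw [div_self hT.ne']; ring

theorem variationWeight_of_ge {ε t : ℝ} (ht : T ≤ t) : variationWeight ε T t = 0 :=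
  if_neg (not_lt.2 ht)

theorem variationWeight_mem_Icc (hT : 0 < T) {ε t : ℝ} (hε : 0 ≤ ε) (ht : 0 ≤ t) :
    variationWeight ε T t ∈ Set.Icc 0 ε := by
  rcases le_total t T with h | h
  · rw [variationWeight_of_le hT h]
    have h1 : t / T ≤ 1 := (div_le_one hT).2 h
    have h2 : 0 ≤ t / T := by positivity
    exact ⟨mul_nonneg hε (by linarith), mul_le_of_le_one_right hε (by linarith)⟩
  · rw [variationWeight_of_ge h]
    exact ⟨le_rfl, hε⟩

theorem hasDerivAt_variationWeight (hT : 0 < T) {ε t : ℝ} (ht : t < T) :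
    HasDerivAt (variationWeight ε T) (-(ε / T)) t := by
  have h : HasDerivAt (fun t : ℝ => ε * (1 - t / T)) (-(ε / T)) t := by
    have := (((hasDerivAt_id t).div_const T).const_sub 1).const_mul ε
    exact this.congr_deriv (by ring)
  refine h.congr_of_eventuallyEq ?_
  filter_upwards [Iio_mem_nhds ht] with s hs using variationWeight_of_le hT (le_of_lt hs)

theorem variation_of_ge {ε t : ℝ} {h : Cn n → Cn n} (ht : T ≤ t) : variation f ε T h t = f t := by
  funext z
  simp [variation, variationWeight_of_ge ht]

theorem fderiv_variation {ε t : ℝ} {h : Cn n → Cn n} {z : Cn n}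
    (hf : DifferentiableAt ℂ (f t) z) (hh : DifferentiableAt ℂ h z) :
    fderiv ℂ (variation f ε T h t) z
      = fderiv ℂ (f t) z + ((variationWeight ε T t : ℝ) : ℂ) • fderiv ℂ h z := by
  unfold variation
  rw [fderiv_fun_add hf (hh.fun_const_smul _), fderiv_fun_const_smul hh]

/-- The pointwise estimate behind the theorem. Here `A = d(f_t)_z`, `d = ∂_t f_t (z)`, `B = dh_z` and
`y = h(z)`, so `v` is the value of the Loewner–Kufarev field of the varied family; the variation
changes the numerical range of the original field by less than the squeezing ratio `c`. -/
theorem re_inner_nonpos_of_perturbation {A B : Cn n →L[ℂ] Cn n} {a b c ε τ α : ℝ}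
    {z d y v : Cn n} (ha : 0 < a) (hτ : 0 ≤ τ) (hε : 0 ≤ ε) (hεa : ε ≤ a / 2)
    (hεc : ε * (((b + a * τ) * 2 / a + τ) / a) ≤ c)
    (hα : α ∈ Set.Icc 0 ε) (hz : z ≠ 0) (hA : ∀ v, a * ‖v‖ ≤ ‖A v‖) (hB : ‖B‖ ≤ 1)
    (hd : ‖d‖ ≤ b * ‖z‖) (hy : ‖y‖ ≤ ‖z‖)
    (hc : c ≤ (inner ℂ (A.inverse d) (((‖z‖ ^ 2)⁻¹ : ℝ) • z)).re)
    (hv : (A + (α : ℂ) • B) v + (d - ((ε * τ : ℝ) : ℂ) • y) = 0) :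
    (inner ℂ z v).re ≤ 0 := by
  have hzp : 0 < ‖z‖ := norm_pos_iff.2 hz
  obtain ⟨e, rfl⟩ := exists_continuousLinearEquiv_of_bounded_below ha hA
  set x := (e : Cn n →L[ℂ] Cn n).inverse d with hx
  have hex : (e : Cn n →L[ℂ] Cn n) x = d := by
    rw [hx, ContinuousLinearMap.inverse_equiv]; simp
  have hBv : ‖B v‖ ≤ ‖v‖ := by simpa using B.le_of_opNorm_le hB v
  have hαB : ‖(α : ℂ) • B v‖ ≤ ε * ‖v‖ := by
    rw [norm_smul, Complex.norm_real, Real.norm_of_nonneg hα.1]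
    exact mul_le_mul hα.2 hBv (norm_nonneg _) hε
  have hτy : ‖((ε * τ : ℝ) : ℂ) • y‖ ≤ ε * τ * ‖z‖ := by
    rw [norm_smul, Complex.norm_real, Real.norm_of_nonneg (by positivity)]
    gcongr
  -- The defect `v + x` solves `A (v + x) = ε τ y - α B v`.
  have heq : (e : Cn n →L[ℂ] Cn n) (v + x) = ((ε * τ : ℝ) : ℂ) • y - (α : ℂ) • B v := by
    rw [map_add, hex]
    rw [_root_.add_apply, _root_.smul_apply] at hv
    rw [← sub_eq_zero, ← hv]
    abel
  have hvx : a * ‖v + x‖ ≤ ε * τ * ‖z‖ + ε * ‖v‖ := by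
    refine (hA _).trans ?_
    rw [heq]
    exact (norm_sub_le _ _).trans (add_le_add hτy hαB)
  have hxn : a * ‖x‖ ≤ b * ‖z‖ := (hA x).trans (by rw [hex]; exact hd)
  have hvn : ‖v‖ ≤ (b + a * τ) * 2 / a * ‖z‖ := by
    have h1 : ‖v‖ ≤ ‖v + x‖ + ‖x‖ := by
      simpa using norm_sub_le (v + x) x
    have h2 : ε * τ * ‖z‖ ≤ a / 2 * τ * ‖z‖ := by gcongr
    have h3 : ε * ‖v‖ ≤ a / 2 * ‖v‖ := by gcongr
    have h4 : 0 ≤ a * τ * ‖z‖ := by positivity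
    have h5 : a * ‖v‖ ≤ a * ‖v + x‖ + a * ‖x‖ := by
      rw [← mul_add]; gcongr
    rw [div_mul_eq_mul_div, le_div_iff₀ ha]
    nlinarith
  have hdef : ‖v + x‖ ≤ c * ‖z‖ := by
    have h1 : a * ‖v + x‖ ≤ a * (ε * (((b + a * τ) * 2 / a + τ) / a) * ‖z‖) := by
      calc a * ‖v + x‖ ≤ ε * τ * ‖z‖ + ε * ((b + a * τ) * 2 / a * ‖z‖) :=
            hvx.trans (by gcongr)
        _ = a * (ε * (((b + a * τ) * 2 / a + τ) / a) * ‖z‖) := by field_simp; ring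
    exact (le_of_mul_le_mul_left h1 ha).trans (by gcongr)
  have hcz : c * ‖z‖ ^ 2 ≤ (inner ℂ z x).re := by
    have h1 : (inner ℂ x (((‖z‖ ^ 2)⁻¹ : ℝ) • z)).re = (‖z‖ ^ 2)⁻¹ * (inner ℂ z x).re := by
      have h2 : (((‖z‖ ^ 2)⁻¹ : ℝ) • z : Cn n) = ((((‖z‖ ^ 2)⁻¹ : ℝ)) : ℂ) • z :=
        (Complex.coe_smul _ _).symm
      have h3 : (inner ℂ x z).re = (inner ℂ z x).re := inner_re_symm (𝕜 := ℂ) x z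
      rw [h2, inner_smul_right, Complex.re_ofReal_mul, h3]
    rw [h1, inv_mul_eq_div, le_div_iff₀ (by positivity)] at hc
    exact hc
  have h1 : (inner ℂ z v).re = (inner ℂ z (v + x)).re - (inner ℂ z x).re := by
    rw [inner_add_right, Complex.add_re]; ring
  have h2 : (inner ℂ z (v + x)).re ≤ ‖z‖ * (c * ‖z‖) :=
    (Complex.re_le_norm _).trans ((norm_inner_le_norm _ _).trans (by gcongr))
  rw [h1]
  nlinarith

theorem isInwardFamily_variation (hf : IsNormalizedSubordinationChain f) (hT : 0 < T) {a c ε : ℝ}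
    (ha0 : 0 < a) (hb0 : 0 ≤ b)
    (ha : ∀ t ∈ Set.Ico 0 T, ∀ z ∈ unitBall n, a ≤ minStretch (fderiv ℂ (f t) z))
    (hb : ∀ᵐ t : ℝ, t ∈ Set.Ico 0 T → ∀ z ∈ unitBall n, ‖deriv (fun s => f s z) t‖ ≤ b)
    (hc : IsExpSqueezingWith f (Set.Ico 0 T) c) (hε : 0 < ε) (hεa : ε ≤ a / 2)
    (hεc : ε * (((b + a * T⁻¹) * 2 / a + T⁻¹) / a) ≤ c) {h : Cn n → Cn n}
    (hh : DifferentiableOn ℂ h (unitBall n)) (h0 : h 0 = 0)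
    (hh1 : ∀ z ∈ unitBall n, ‖h z‖ ≤ 1) (hdh : ∀ z ∈ unitBall n, ‖fderiv ℂ h z‖ ≤ 1) :
    IsInwardFamily (variation f ε T h) T (a / 2) (b + ε / T) := by
  have hdf : ∀ t, 0 ≤ t → ∀ z ∈ unitBall n, DifferentiableAt ℂ (f t) z := fun t ht z hz =>
    (hf.holomorphic t ht).differentiableAt (Metric.isOpen_ball.mem_nhds hz)
  have hdh' : ∀ z ∈ unitBall n, DifferentiableAt ℂ h z := fun z hz =>
    hh.differentiableAt (Metric.isOpen_ball.mem_nhds hz)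
  have hlow := fun t ht z hz =>
    mul_norm_le_norm_fderiv_of_mem_Icc hf hT hb0 hb ha (t := t) ht (z := z) hz
  refine ⟨fun t ht => (hf.holomorphic t ht.1).add (hh.fun_const_smul _), ?_, ?_, ?_⟩
  · intro t ht z hz v
    rw [fderiv_variation (hdf t ht.1 z hz) (hdh' z hz), _root_.add_apply,
      _root_.smul_apply]
    have h1 := hlow t ht z hz v
    have hα := variationWeight_mem_Icc hT hε.le ht.1
    have h2 : ‖((variationWeight ε T t : ℝ) : ℂ) • fderiv ℂ h z v‖ ≤ a / 2 * ‖v‖ := by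
      rw [norm_smul, Complex.norm_real, Real.norm_of_nonneg hα.1]
      have := (fderiv ℂ h z).le_of_opNorm_le (hdh z hz) v
      rw [one_mul] at this
      exact mul_le_mul (hα.2.trans hεa) this (norm_nonneg _) (by positivity)
    have h3 := norm_sub_le_norm_add (fderiv ℂ (f t) z v)
      (((variationWeight ε T t : ℝ) : ℂ) • fderiv ℂ h z v)
    linarith
  · intro s hs t ht z hz
    have h1 := hf.norm_sub_le_of_ae_norm_deriv_le hT.le hb0 hb hs ht hz
    have h2 : variation f ε T h t z - variation f ε T h s z
        = (f t z - f s z) + ((-(ε / T) * (t - s) : ℝ) : ℂ) • h z := by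
      simp only [variation, variationWeight_of_le hT hs.2, variationWeight_of_le hT ht.2]
      have : (-(ε / T) * (t - s) : ℝ) = ε * (1 - t / T) - ε * (1 - s / T) := by ring
      rw [this, Complex.ofReal_sub, sub_smul]
      abel
    have hz1 := (mem_ball_zero_iff.1 hz).le
    rw [h2]
    calc ‖(f t z - f s z) + ((-(ε / T) * (t - s) : ℝ) : ℂ) • h z‖
        ≤ ‖f t z - f s z‖ + ‖((-(ε / T) * (t - s) : ℝ) : ℂ) • h z‖ := norm_add_le _ _
      _ ≤ b * |t - s| * 1 + ε / T * |t - s| * 1 := by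
          refine add_le_add (h1.trans (by gcongr)) ?_
          rw [norm_smul, Complex.norm_real, Real.norm_eq_abs, abs_mul, abs_neg,
            abs_of_nonneg (by positivity : 0 ≤ ε / T)]
          gcongr
          exact hh1 z hz
      _ = (b + ε / T) * |t - s| := by ring
  · obtain ⟨hc0, -, hcae⟩ := hc
    filter_upwards [hcae] with t htc ht z hz hz0
    have htI : t ∈ Set.Ico 0 T := Set.Ioo_subset_Ico_self ht
    have hcz := htc htI z hz hz0
    have hdiff : DifferentiableAt ℝ (fun s => f s z) t := by
      by_contra hnd
      rw [deriv_zero_of_not_differentiableAt hnd, map_zero, inner_zero_left, Complex.zero_re] at hcz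
      linarith
    have hα : HasDerivAt (fun s => ((variationWeight ε T s : ℝ) : ℂ) • h z)
        (((-(ε / T) : ℝ) : ℂ) • h z) t :=
      (hasDerivAt_variationWeight hT ht.2).ofReal_comp.smul_const (h z)
    have hder : HasDerivAt (fun s => variation f ε T h s z)
        (deriv (fun s => f s z) t + ((-(ε / T) : ℝ) : ℂ) • h z) t := hdiff.hasDerivAt.add hα
    refine ⟨hder.differentiableAt, fun v hv => ?_⟩
    rw [hder.deriv, fderiv_variation (hdf t ht.1.le z hz) (hdh' z hz)] at hv
    refine re_inner_nonpos_of_perturbation (τ := T⁻¹) ha0 (by positivity) hε.le hεa hεc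
      (variationWeight_mem_Icc hT hε.le ht.1.le) hz0
      (hlow t (Set.Ioo_subset_Icc_self ht) z hz) (hdh z hz)
      (hf.norm_deriv_le_mul_norm hT.le hb0 hb ht hz)
      (Complex.norm_le_norm_of_mapsTo_ball hh (fun x hx => by simpa using hh1 x hx) h0
        (mem_ball_zero_iff.1 hz)) hcz (y := h z) ?_
    rw [← div_eq_mul_inv, sub_eq_add_neg, ← neg_smul, ← Complex.ofReal_neg]
    exact hv

/-! ### The varied family is a Loewner chain -/

theorem isNormalizedLoewnerChain_variation (hf : IsNormalizedLoewnerChain f) (hT : 0 < T)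
    {m B ε : ℝ} (hm : 0 < m) (hB : 0 ≤ B) {h : Cn n → Cn n}
    (hh : DifferentiableOn ℂ h (unitBall n)) (h0 : h 0 = 0) (hd0 : fderiv ℂ h 0 = 0)
    (hg : IsInwardFamily (variation f ε T h) T m B) :
    IsNormalizedLoewnerChain (variation f ε T h) := by
  have hb : unitBall n ∈ 𝓝 (0 : Cn n) := Metric.ball_mem_nhds _ one_pos
  have hinj : Set.InjOn (variation f ε T h T) (unitBall n) := by
    rw [variation_of_ge le_rfl]
    exact hf.univalent T hT.le
  refine ⟨⟨fun t ht => (hf.holomorphic t ht).add (hh.fun_const_smul _), fun t ht => ?_,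
    fun t ht => ?_, fun s t hs hst => ?_⟩, fun t ht => ?_⟩
  · simp [variation, hf.map_zero t ht, h0]
  · rw [fderiv_variation ((hf.holomorphic t ht).differentiableAt hb) (hh.differentiableAt hb), hd0,
      hf.fderiv_zero t ht]
    ext1 v
    simp
  · rcases le_total t T with htT | htT
    · exact hg.exists_transition hT.le hB hm hinj hs hst htT
    rcases le_total T s with hsT | hsT
    · rw [variation_of_ge hsT, variation_of_ge htT]
      exact hf.subordinate s t hs hst
    · obtain ⟨ψ, hψ, hψm, hψ0, hψe⟩ := hg.exists_transition hT.le hB hm hinj hs hsT le_rfl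
      obtain ⟨φ, hφ, hφm, hφ0, hφe⟩ := hf.subordinate T t hT.le htT
      refine ⟨φ ∘ ψ, hφ.comp hψ hψm, hφm.comp hψm, by simp [hψ0, hφ0], fun z hz => ?_⟩
      rw [hψe z hz, variation_of_ge le_rfl, variation_of_ge htT]
      exact hφe _ (hψm hz)
  · rcases le_total t T with htT | htT
    · exact hg.injOn hT.le hB hm hinj ⟨ht, htT⟩
    · rw [variation_of_ge htT]
      exact hf.univalent t ht

/-- Adding bounded multiples of a fixed bounded map preserves normality, because the multiples
themselves have a convergent subsequence. -/
theorem isNormalFamily_variation {ε : ℝ} (hT : 0 < T) (hε : 0 ≤ ε) {h : Cn n → Cn n}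
    (hh1 : ∀ z ∈ unitBall n, ‖h z‖ ≤ 1)
    (hf : IsNormalFamily
      {g | ∃ t : ℝ, 0 ≤ t ∧ g = fun z => ((Real.exp (-t) : ℝ) : ℂ) • f t z} (unitBall n)) :
    IsNormalFamily
      {g | ∃ t : ℝ, 0 ≤ t ∧ g = fun z => ((Real.exp (-t) : ℝ) : ℂ) • variation f ε T h t z}
      (unitBall n) := by
  intro u hu
  choose t ht hut using hu
  obtain ⟨σ, g, hσ, hconv⟩ := hf (fun k z => ((Real.exp (-t k) : ℝ) : ℂ) • f (t k) z)
    fun k => ⟨t k, ht k, rfl⟩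
  set β : ℕ → ℝ := fun k => Real.exp (-t (σ k)) * variationWeight ε T (t (σ k)) with hβ
  have hβm : ∀ k, β k ∈ Set.Icc 0 ε := fun k => by
    have h1 := variationWeight_mem_Icc hT hε (ht (σ k))
    have h2 : Real.exp (-t (σ k)) ≤ 1 := by rw [Real.exp_le_one_iff]; linarith [ht (σ k)]
    exact ⟨mul_nonneg (Real.exp_pos _).le h1.1,
      (mul_le_of_le_one_left h1.1 h2).trans h1.2⟩
  obtain ⟨β₀, -, τ, hτ, hβτ⟩ := isCompact_Icc.tendsto_subseq hβm
  refine ⟨σ ∘ τ, fun z => g z + (β₀ : ℂ) • h z, hσ.comp hτ, fun K hK hKc => ?_⟩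
  have h1 : TendstoUniformlyOn
      (fun k z => ((Real.exp (-t (σ (τ k))) : ℝ) : ℂ) • f (t (σ (τ k))) z) g atTop K := by
    intro V hV
    exact hτ.tendsto_atTop.eventually (hconv K hK hKc V hV)
  have h2 : TendstoUniformlyOn (fun k z => (β (τ k) : ℂ) • h z) (fun z => (β₀ : ℂ) • h z)
      atTop K := by
    rw [Metric.tendstoUniformlyOn_iff]
    intro δ hδ
    filter_upwards [Metric.tendsto_nhds.1 hβτ δ hδ] with k hk z hz
    rw [dist_comm, dist_eq_norm, ← sub_smul, norm_smul, ← Complex.ofReal_sub, Complex.norm_real,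
      ← dist_eq_norm]
    exact (mul_le_of_le_one_right dist_nonneg (hh1 z (hK hz))).trans_lt hk
  refine (h1.add h2).congr (Eventually.of_forall fun k z _ => ?_)
  simp only [Function.comp_apply, hut, variation, smul_add, smul_smul, hβ, Pi.add_apply]
  push_cast
  rfl

end Loewner

open Loewner in
theorem theorem3p1 {n : ℕ} (f : ℝ → Cn n → Cn n) (hf : IsNormalizedLoewnerChain f)
    (T : ℝ) (hT : 0 < T) (hger : IsGeraumigOn f (Set.Ico 0 T)) :
    ∃ ε₀ : ℝ, 0 < ε₀ ∧ ∀ ε : ℝ, 0 < ε → ε ≤ ε₀ →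
      ∀ h : Cn n → Cn n, DifferentiableOn ℂ h (unitBall n) → h 0 = 0 → fderiv ℂ h 0 = 0 →
        (∀ z ∈ unitBall n, ‖h z‖ ≤ 1) → (∀ z ∈ unitBall n, ‖fderiv ℂ h z‖ ≤ 1) →
        IsNormalizedLoewnerChain (variation f ε T h) ∧
          (IsNormalLoewnerChain f → IsNormalLoewnerChain (variation f ε T h)) := by
  obtain ⟨a, b, ha0, hb0, ha, hb, c, hc⟩ := hger
  set V := ((b + a * T⁻¹) * 2 / a + T⁻¹) / a with hV
  have hV0 : 0 < V := by positivity
  have hc0 := hc.1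
  refine ⟨min (a / 2) (c / V), by positivity, fun ε hε hεle h hh h0 hd0 hh1 hdh => ?_⟩
  have hεc : ε * V ≤ c := (le_div_iff₀ hV0).1 (hεle.trans (min_le_right _ _))
  have hg := isInwardFamily_variation hf.toIsNormalizedSubordinationChain hT ha0 hb0.le ha hb hc hε
    (hεle.trans (min_le_left _ _)) hεc hh h0 hh1 hdh
  have hchain := isNormalizedLoewnerChain_variation hf hT (by positivity) (by positivity) hh h0 hd0
    hg
  exact ⟨hchain, fun hn => ⟨hchain, isNormalFamily_variation hT hε.le hh1 hn.normal⟩⟩
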